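/- Let $V_1,V_2>0$ be the (unique) pair of $C^2$ functions on $\mathbb R$ with $$-V_1''+V_1V_2^2=0,\qquad -V_2''+V_2V_1^2=0\qquad\text{in }\mathbb R,$$ $V_1(0)=V_2(0)=1$, $V_1(-x)=V_2(x)$ and $V_1'(x)>0$ for all $x\in\mathbb R$, such that, for some constants $A>0$, $B\in\mathbb R$, $c>0$, $V_1(x)=Ax+B+\mathcal O(e^{-cx^2})$ as $x\to+\infty$ and $V_1(x)=\mathcal O(e^{-cx^2})$ as $x\to-\infty$. For $\omega\ge 0$ let $$L_\omega=\begin{pmatrix}-\partial_x^2+V_2^2 & 2V_1V_2\\ 2V_1V_2 & -\partial_x^2+V_1^2\end{pmatrix}+\omega^2\,\mathrm{Id}.$$ For a pair $f=(f_1,f_2)$ of functions on $(-R,R)$ put $\|f\|_{C^0((-R,R))}=\sup_{|x|<R}\max(|f_1(x)|,|f_2(x)|)\in[0,\infty]$. Given $\theta>0$, there exist constants $C,R_0,\omega_0,P_0>0$ such that the following holds for all $R>R_0$ and all $\omega\in(0,\omega_0)$ with $\omega R>P_0$. If $\varphi=(\varphi_1,\varphi_2)$ is continuous on $[-R,R]$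 and $C^2$ on $(-R,R)$ and satisfies, for some $g=(g_1,g_2)$, $$L_\omega\varphi=g\ \text{ in }(-R,R),\qquad \varphi(\pm R)=0,$$ then $$\|\varphi\|_{C^0((-R,R))}\le C\,\omega^{-1}\,\|g\cosh(\theta x)\|_{C^0((-R,R))}.$$ -/

import Mathlib

open Set Filter Asymptotics
open scoped ENNReal

/-- `V = (V₁, V₂)` is the one-dimensional heteroclinic solution: a positive `C²` solution on `ℝ` of
`-V₁'' + V₁ V₂² = 0`, `-V₂'' + V₂ V₁² = 0` with `V₁(0) = V₂(0) = 1`, `V₁(-x) = V₂(x)`, `V₁' > 0`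
and, for some `A > 0`, `B` and `c > 0`, `V₁(x) = A x + B + O(exp(-c x²))` as `x → +∞` and
`V₁(x) = O(exp(-c x²))` as `x → -∞`. -/
structure IsHeteroclinic (V₁ V₂ : ℝ → ℝ) : Prop where
  contDiff₁ : ContDiff ℝ 2 V₁
  contDiff₂ : ContDiff ℝ 2 V₂
  pos₁ : ∀ x, 0 < V₁ x
  pos₂ : ∀ x, 0 < V₂ x
  ode₁ : ∀ x, -deriv (deriv V₁) x + V₁ x * V₂ x ^ 2 = 0
  ode₂ : ∀ x, -deriv (deriv V₂) x + V₂ x * V₁ x ^ 2 = 0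
  at_zero₁ : V₁ 0 = 1
  at_zero₂ : V₂ 0 = 1
  symmetric : ∀ x, V₁ (-x) = V₂ x
  deriv_pos : ∀ x, 0 < deriv V₁ x
  asymptotics : ∃ A B c : ℝ, 0 < A ∧ 0 < c ∧
    (fun x => V₁ x - (A * x + B)) =O[atTop] (fun x => Real.exp (-c * x ^ 2)) ∧
    V₁ =O[atBot] (fun x => Real.exp (-c * x ^ 2))

/-- The linearized operator `L_ω`, that is, the matrix operator with rows
`(-∂² + V₂², 2 V₁ V₂)` and `(2 V₁ V₂, -∂² + V₁²)`, plus `ω² Id`. -/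
noncomputable def linearizedOp (V₁ V₂ : ℝ → ℝ) (ω : ℝ) (φ : ℝ → ℝ × ℝ) (x : ℝ) : ℝ × ℝ :=
  (-deriv (deriv fun y => (φ y).1) x + V₂ x ^ 2 * (φ x).1 + 2 * V₁ x * V₂ x * (φ x).2
      + ω ^ 2 * (φ x).1,
   2 * V₁ x * V₂ x * (φ x).1 - deriv (deriv fun y => (φ y).2) x + V₁ x ^ 2 * (φ x).2
      + ω ^ 2 * (φ x).2)

/-- `φ` is a classical solution of `L_ω φ = g` in `(-R, R)`, `φ(±R) = 0`. The continuity of `g` on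
`(-R, R)` follows from the equation. -/
structure IsDirichletSolution (V₁ V₂ : ℝ → ℝ) (ω R : ℝ) (g φ : ℝ → ℝ × ℝ) : Prop where
  contDiffOn : ContDiffOn ℝ 2 φ (Ioo (-R) R)
  continuousOn : ContinuousOn φ (Icc (-R) R)
  equation : ∀ x ∈ Ioo (-R) R, linearizedOp V₁ V₂ ω φ x = g x
  left_eq_zero : φ (-R) = 0
  right_eq_zero : φ R = 0

/-- The norm of `C⁰((-R, R))`, as an extended nonnegative real (it is `∞` exactly when `f` is
unbounded there); pairs carry the maximum norm. -/
noncomputable def normC0 (R : ℝ) (f : ℝ → ℝ × ℝ) : ℝ≥0∞ :=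
  ⨆ x ∈ Ioo (-R) R, ‖f x‖ₑ

/-- The weighted norm `‖g cosh(θ x)‖` in `C⁰((-R, R))`. -/
noncomputable def weightedNormC0 (θ R : ℝ) (g : ℝ → ℝ × ℝ) : ℝ≥0∞ :=
  normC0 R fun x => Real.cosh (θ * x) • g x

/-!
Differentiating the system for `V` shows that `(V₁', V₂')` is annihilated by `L_0`, and its
components have constant signs, `V₁' > 0 > V₂'`. Writing `φᵢ = zᵢ Vᵢ'` turns `L_ω φ = g` into the
energy identity (`IsDirichletSolution.exists_hasDerivAt_energyFlux`)
`∫ (∑ᵢ (Vᵢ' zᵢ')² - 2 V₁ V₂ V₁' V₂' (z₁ - z₂)² + ω² |φ|²) = ∫ g · φ`,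
in which every term on the left is nonnegative.

The energy controls `φ` pointwise (`IsDirichletSolution.omega_mul_sq_fst_le`): as `V₁'` is positive
and increasing and `z₁ (R) = 0`,
`ω φ₁(x)² = ω V₁'(x)² z₁(x)² ≤ ∫_x^R 2 ω (V₁')² |z₁ z₁'| ≤ ∫_x^R ((V₁' z₁')² + ω² φ₁²) ≤ ∫ |g · φ|`.
By the symmetry `V₁(-x) = V₂(x)` the same holds for `φ₂` (`IsDirichletSolution.reflect`). If `S` is
the maximum of `‖φ‖` and `G` the weighted norm of `g`, then `|g · φ| ≤ 2 G S sech (θ x)`, so that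
`ω S² ≤ (2 π / θ) G S`, which is the claim with `C = 2 π / θ`, for every `R` and every
`ω > 0`.

The integrated inequalities are obtained as monotonicity statements on compact subintervals, where
`φ` is `C²`. Since the derivative of `φ` is not controlled at `±R`, the boundary terms are discarded
along points supplied by the mean value theorem (`exists_deriv_nonpos_lt_of_eq_zero`).
-/

/-! ### The heteroclinic solution -/

namespace IsHeteroclinic

variable {V₁ V₂ : ℝ → ℝ}

lemma hasDerivAt₁ (hV : IsHeteroclinic V₁ V₂) (x : ℝ) : HasDerivAt V₁ (deriv V₁ x) x :=
  (hV.contDiff₁.differentiable (by norm_num) x).hasDerivAt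

lemma hasDerivAt₂ (hV : IsHeteroclinic V₁ V₂) (x : ℝ) : HasDerivAt V₂ (deriv V₂ x) x :=
  (hV.contDiff₂.differentiable (by norm_num) x).hasDerivAt

lemma hasDerivAt_deriv₁ (hV : IsHeteroclinic V₁ V₂) (x : ℝ) :
    HasDerivAt (deriv V₁) (V₁ x * V₂ x ^ 2) x := by
  have h := (hV.contDiff₁.differentiable_deriv_two x).hasDerivAt
  rwa [show deriv (deriv V₁) x = V₁ x * V₂ x ^ 2 by linarith [hV.ode₁ x]] at h

lemma hasDerivAt_deriv₂ (hV : IsHeteroclinic V₁ V₂) (x : ℝ) :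
    HasDerivAt (deriv V₂) (V₂ x * V₁ x ^ 2) x := by
  have h := (hV.contDiff₂.differentiable_deriv_two x).hasDerivAt
  rwa [show deriv (deriv V₂) x = V₂ x * V₁ x ^ 2 by linarith [hV.ode₂ x]] at h

lemma deriv_neg (hV : IsHeteroclinic V₁ V₂) (x : ℝ) : deriv V₂ x < 0 := by
  rw [show V₂ = fun y => V₁ (-y) from funext fun y => (hV.symmetric y).symm, deriv_comp_neg]
  linarith [hV.deriv_pos (-x)]

lemma deriv_monotone (hV : IsHeteroclinic V₁ V₂) : Monotone (deriv V₁) :=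
  monotone_of_hasDerivAt_nonneg (f' := fun x => V₁ x * V₂ x ^ 2) hV.hasDerivAt_deriv₁
    fun x => mul_nonneg (hV.pos₁ x).le (sq_nonneg _)

end IsHeteroclinic

/-! ### Behaviour at an endpoint -/

/-- Near a right endpoint at which a nonnegative function vanishes, there are points where its
derivative is nonpositive, so that no control of the derivative at the endpoint is needed. -/
lemma exists_deriv_nonpos_lt_of_eq_zero {N N' E : ℝ → ℝ} {l r ε : ℝ} (hlr : l < r)
    (hN : ContinuousOn N (Icc l r)) (hd : ∀ x ∈ Ioo l r, HasDerivAt N (N' x) x)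
    (hN0 : ∀ x, 0 ≤ N x) (hNr : N r = 0)
    (hE : ContinuousOn E (Icc l r)) (hEr : E r < ε) :
    ∃ t ∈ Ioo l r, N' t ≤ 0 ∧ E t < ε := by
  have hev : ∀ᶠ x in nhdsWithin r (Iio r), E x < ε := by
    have h : ∀ᶠ x in nhdsWithin r (Icc l r), E x < ε :=
      (hE r (right_mem_Icc.2 hlr.le)).eventually_lt_const hEr
    rw [← nhdsWithin_Ioo_eq_nhdsLT hlr]
    exact h.filter_mono (nhdsWithin_mono r Ioo_subset_Icc_self)
  obtain ⟨d, ⟨hld, hdr⟩, hd'⟩ := (mem_nhdsLT_iff_exists_mem_Ico_Ioo_subset hlr).1 hev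
  obtain ⟨t, ht, hslope⟩ := exists_hasDerivAt_eq_slope N N' hdr
    (hN.mono (Icc_subset_Icc_left hld)) fun x hx => hd x ⟨hld.trans_lt hx.1, hx.2⟩
  refine ⟨t, ⟨hld.trans_lt ht.1, ht.2⟩, ?_, hd' ht⟩
  rw [hslope, hNr]
  exact div_nonpos_of_nonpos_of_nonneg (by linarith [hN0 d]) (by linarith)

lemma exists_deriv_nonneg_lt_of_eq_zero {N N' E : ℝ → ℝ} {l r ε : ℝ} (hlr : l < r)
    (hN : ContinuousOn N (Icc l r)) (hd : ∀ x ∈ Ioo l r, HasDerivAt N (N' x) x)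
    (hN0 : ∀ x, 0 ≤ N x) (hNl : N l = 0)
    (hE : ContinuousOn E (Icc l r)) (hEl : E l < ε) :
    ∃ t ∈ Ioo l r, 0 ≤ N' t ∧ E t < ε := by
  have hmaps : MapsTo (fun x : ℝ => -x) (Icc (-r) (-l)) (Icc l r) := fun x hx =>
    ⟨by linarith [hx.2], by linarith [hx.1]⟩
  obtain ⟨t, ht, h₁, h₂⟩ := exists_deriv_nonpos_lt_of_eq_zero (N := fun x => N (-x))
    (N' := fun x => -N' (-x)) (E := fun x => E (-x)) (ε := ε) (neg_lt_neg hlr)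
    (hN.comp continuous_neg.continuousOn hmaps)
    (fun x hx => by
      have := (hd (-x) ⟨by linarith [hx.2], by linarith [hx.1]⟩).comp x (hasDerivAt_neg x)
      rw [mul_neg_one] at this
      exact this)
    (fun x => hN0 _) (by simpa using hNl)
    (hE.comp continuous_neg.continuousOn hmaps) (by simpa using hEl)
  exact ⟨-t, ⟨by linarith [ht.2], by linarith [ht.1]⟩, by linarith, h₂⟩

lemma ContDiffOn.hasDerivAt_of_two {f : ℝ → ℝ} {s : Set ℝ} (hf : ContDiffOn ℝ 2 f s)
    (hs : IsOpen s) {x : ℝ} (hx : x ∈ s) :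
    HasDerivAt f (deriv f x) x ∧ HasDerivAt (deriv f) (deriv (deriv f) x) x := by
  have h1 : ContDiffOn ℝ 1 (deriv f) s := hf.deriv_of_isOpen hs (by norm_num)
  exact ⟨((hf.differentiableOn (by norm_num)).differentiableAt (hs.mem_nhds hx)).hasDerivAt,
    ((h1.differentiableOn (by norm_num)).differentiableAt (hs.mem_nhds hx)).hasDerivAt⟩

/-! ### The energy flux and the a priori bound -/

/-- The flux `φ₁ φ₁' - φ₁² V₁''/V₁' + φ₂ φ₂' - φ₂² V₂''/V₂'`, where `V₁''` and `V₂''` are replaced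
by `V₁ V₂²` and `V₂ V₁²`. With `φᵢ = zᵢ Vᵢ'` it equals `∑ᵢ (Vᵢ')² zᵢ zᵢ'`. -/
noncomputable def energyFlux (V₁ V₂ : ℝ → ℝ) (φ : ℝ → ℝ × ℝ) (x : ℝ) : ℝ :=
  (φ x).1 * deriv (fun y => (φ y).1) x - (φ x).1 ^ 2 * (V₁ x * V₂ x ^ 2) / deriv V₁ x
    + ((φ x).2 * deriv (fun y => (φ y).2) x - (φ x).2 ^ 2 * (V₂ x * V₁ x ^ 2) / deriv V₂ x)

namespace IsDirichletSolution

variable {V₁ V₂ : ℝ → ℝ} {ω R : ℝ} {g φ : ℝ → ℝ × ℝ}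

lemma contDiffOn_fst (h : IsDirichletSolution V₁ V₂ ω R g φ) :
    ContDiffOn ℝ 2 (fun y => (φ y).1) (Ioo (-R) R) := contDiff_fst.comp_contDiffOn h.contDiffOn

lemma contDiffOn_snd (h : IsDirichletSolution V₁ V₂ ω R g φ) :
    ContDiffOn ℝ 2 (fun y => (φ y).2) (Ioo (-R) R) := contDiff_snd.comp_contDiffOn h.contDiffOn

/-- Interchanging the components and reflecting the variable preserves the Dirichlet problem. -/
lemma reflect (hV : IsHeteroclinic V₁ V₂) (h : IsDirichletSolution V₁ V₂ ω R g φ) :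
    IsDirichletSolution V₁ V₂ ω R (fun x => (g (-x)).swap) (fun x => (φ (-x)).swap) where
  contDiffOn := by
    have := h.contDiffOn.comp (contDiff_neg (n := 2)).contDiffOn (s := Ioo (-R) R)
      fun x hx => ⟨by linarith [hx.2], by linarith [hx.1]⟩
    exact (contDiff_snd.comp_contDiffOn this).prodMk (contDiff_fst.comp_contDiffOn this)
  continuousOn := continuous_swap.comp_continuousOn <|
    h.continuousOn.comp continuous_neg.continuousOn
      fun x hx => ⟨by linarith [hx.2], by linarith [hx.1]⟩
  equation := by
    intro x hx
    have hV₂ : V₂ (-x) = V₁ x := by rw [← hV.symmetric, neg_neg]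
    have hdd (f : ℝ → ℝ) : deriv (deriv fun y => f (-y)) x = deriv (deriv f) (-x) := by
      rw [show deriv (fun y => f (-y)) = fun y => -deriv f (-y) from
        funext fun y => deriv_comp_neg f y, deriv.fun_neg, deriv_comp_neg, neg_neg]
    rw [← h.equation (-x) ⟨by linarith [hx.2], by linarith [hx.1]⟩]
    simp only [linearizedOp, Prod.swap, hV.symmetric, hV₂]
    rw [hdd fun y => (φ y).2, hdd fun y => (φ y).1]
    ext <;> ring
  left_eq_zero := by simp [h.right_eq_zero]
  right_eq_zero := by simp [h.left_eq_zero]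

/-- The derivative of the flux is the energy density of the pair `zᵢ = φᵢ / Vᵢ'` plus `ω² |φ|²`
minus `g · φ`. The part of the density involving only `φ₂` and the coupling term
`-2 V₁ V₂ V₁' V₂' (z₁ - z₂)²`, which is nonnegative because `V₁' > 0 > V₂'`, are dropped. -/
lemma exists_hasDerivAt_energyFlux (hV : IsHeteroclinic V₁ V₂)
    (h : IsDirichletSolution V₁ V₂ ω R g φ) {x : ℝ} (hx : x ∈ Ioo (-R) R) :
    ∃ F', HasDerivAt (energyFlux V₁ V₂ φ) F' x ∧
      (deriv (fun y => (φ y).1) x - (φ x).1 * (V₁ x * V₂ x ^ 2) / deriv V₁ x) ^ 2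
        + ω ^ 2 * (φ x).1 ^ 2 - ((g x).1 * (φ x).1 + (g x).2 * (φ x).2) ≤ F' := by
  obtain ⟨hu, hu'⟩ := h.contDiffOn_fst.hasDerivAt_of_two isOpen_Ioo hx
  obtain ⟨hw, hw'⟩ := h.contDiffOn_snd.hasDerivAt_of_two isOpen_Ioo hx
  have e₁ := congrArg Prod.fst (h.equation x hx)
  have e₂ := congrArg Prod.snd (h.equation x hx)
  simp only [linearizedOp] at e₁ e₂
  have hv₁ := hV.hasDerivAt₁ x
  have hv₂ := hV.hasDerivAt₂ x
  have ha := hV.deriv_pos x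
  have hb := hV.deriv_neg x
  refine ⟨_, ((hu.mul hu').sub (((hu.pow 2).mul (hv₁.mul (hv₂.pow 2))).div
    (hV.hasDerivAt_deriv₁ x) ha.ne')).add ((hw.mul hw').sub
      (((hw.pow 2).mul (hv₂.mul (hv₁.pow 2))).div (hV.hasDerivAt_deriv₂ x) hb.ne)), ?_⟩
  have p₁ := hV.pos₁ x
  have p₂ := hV.pos₂ x
  simp only [Pi.mul_apply, Pi.pow_apply]
  generalize deriv (deriv fun y => (φ y).1) x = u'' at *
  generalize deriv (deriv fun y => (φ y).2) x = w'' at *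
  generalize deriv (fun y => (φ y).1) x = u' at *
  generalize deriv (fun y => (φ y).2) x = w' at *
  generalize (φ x).1 = u at *
  generalize (φ x).2 = w at *
  generalize deriv V₁ x = a at *
  generalize deriv V₂ x = b at *
  generalize V₁ x = v at *
  generalize V₂ x = z at *
  have key : 0 ≤ (w' - w * (z * v ^ 2) / b) ^ 2 + ω ^ 2 * w ^ 2
      + 2 * v * z * (u * b - w * a) ^ 2 / (a * -b) := by
    have : 0 < a * -b := mul_pos ha (neg_pos.2 hb)
    positivity
  rw [← sub_nonneg]
  refine key.trans_eq ?_
  rw [← e₁, ← e₂]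
  have := ha.ne'
  have := hb.ne
  field_simp
  ring

/-- The pointwise bound on the first component by the total work of the source: if `g · φ ≤ T'` on
`(-R, R)` and `T` has oscillation at most `m`, then `ω φ₁² ≤ m`. -/
lemma omega_mul_sq_fst_le (hV : IsHeteroclinic V₁ V₂) (h : IsDirichletSolution V₁ V₂ ω R g φ)
    (hω : 0 < ω) {T τ : ℝ → ℝ} {m : ℝ} (hT : ∀ x, HasDerivAt T (τ x) x)
    (hm : ∀ s t, T t - T s ≤ m)
    (hg : ∀ x ∈ Ioo (-R) R, (g x).1 * (φ x).1 + (g x).2 * (φ x).2 ≤ τ x)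
    {x₀ : ℝ} (hx₀ : x₀ ∈ Ioo (-R) R) : ω * (φ x₀).1 ^ 2 ≤ m := by
  set u : ℝ → ℝ := fun y => (φ y).1 with hu_def
  set w : ℝ → ℝ := fun y => (φ y).2 with hw_def
  have hu (x) (hx : x ∈ Ioo (-R) R) : HasDerivAt u (deriv u x) x :=
    (h.contDiffOn_fst.hasDerivAt_of_two isOpen_Ioo hx).1
  have hw (x) (hx : x ∈ Ioo (-R) R) : HasDerivAt w (deriv w x) x :=
    (h.contDiffOn_snd.hasDerivAt_of_two isOpen_Ioo hx).1
  have hR : -R < R := hx₀.1.trans hx₀.2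
  have cu : ContinuousOn u (Icc (-R) R) := continuous_fst.comp_continuousOn h.continuousOn
  have cw : ContinuousOn w (Icc (-R) R) := continuous_snd.comp_continuousOn h.continuousOn
  have ca : Continuous (deriv V₁) := hV.contDiff₁.continuous_deriv (by norm_num)
  have cb : Continuous (deriv V₂) := hV.contDiff₂.continuous_deriv (by norm_num)
  have cv₁ := hV.contDiff₁.continuous
  have cv₂ := hV.contDiff₂.continuous
  have ha := hV.deriv_pos
  have hb := hV.deriv_neg
  choose! F' hF' hFle using fun x hx => h.exists_hasDerivAt_energyFlux hV (x := x) hx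
  set F := energyFlux V₁ V₂ φ
  -- `H` dominates at `x₀` and decays no faster than the energy density to the right of `x₀`,
  -- because `V₁'` is increasing.
  set H : ℝ → ℝ := fun x => ω * (deriv V₁ x₀ ^ 2 * (u x ^ 2 / deriv V₁ x ^ 2)) with hH
  have mono₁ : ∀ s ∈ Ioo (-R) x₀, F s + T s ≤ F x₀ + T x₀ := by
    intro s hs
    have hsub : Icc s x₀ ⊆ Ioo (-R) R := Icc_subset_Ioo hs.1 hx₀.2
    have hK (x) (hx : x ∈ Icc s x₀) : HasDerivAt (fun y => F y + T y) (F' x + τ x) x :=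
      (hF' x (hsub hx)).add (hT x)
    refine monotoneOn_of_hasDerivWithinAt_nonneg (convex_Icc s x₀)
      (fun x hx => (hK x hx).continuousAt.continuousWithinAt)
      (fun x hx => (hK x (interior_subset hx)).hasDerivWithinAt) (fun x hx => ?_)
      (left_mem_Icc.2 hs.2.le) (right_mem_Icc.2 hs.2.le) hs.2.le
    have hx' := hsub (interior_subset hx)
    have := hFle x hx'
    have := hg x hx'
    nlinarith [sq_nonneg (deriv u x - u x * (V₁ x * V₂ x ^ 2) / deriv V₁ x),
      sq_nonneg (ω * u x)]
  have mono₂ : ∀ t ∈ Ioo x₀ R, F x₀ + T x₀ + H x₀ ≤ F t + T t + H t := by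
    intro t ht
    have hsub : Icc x₀ t ⊆ Ioo (-R) R := Icc_subset_Ioo hx₀.1 ht.2
    have hK (x) (hx : x ∈ Icc x₀ t) :=
      ((hF' x (hsub hx)).add (hT x)).add (((((hu x (hsub hx)).pow 2).div
        ((hV.hasDerivAt_deriv₁ x).pow 2) (pow_ne_zero 2 (ha x).ne')).const_mul
          (deriv V₁ x₀ ^ 2)).const_mul ω)
    refine monotoneOn_of_hasDerivWithinAt_nonneg (f := fun y => F y + T y + H y)
      (convex_Icc x₀ t)
      (fun x hx => (hK x hx).continuousAt.continuousWithinAt)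
      (fun x hx => (hK x (interior_subset hx)).hasDerivWithinAt) (fun x hx => ?_)
      (left_mem_Icc.2 ht.1.le) (right_mem_Icc.2 ht.1.le) ht.1.le
    have hx' := hsub (interior_subset hx)
    have h₁ := hFle x hx'
    have h₂ := hg x hx'
    have hle : deriv V₁ x₀ ≤ deriv V₁ x := hV.deriv_monotone (interior_subset hx).1
    set a := deriv V₁ x
    set a₀ := deriv V₁ x₀
    have ha' : 0 < a := ha x
    set q := deriv u x - u x * (V₁ x * V₂ x ^ 2) / a with hq
    set ρ := (a₀ / a) ^ 2 with hρ
    have hρ1 : ρ ≤ 1 := pow_le_one₀ (div_nonneg (ha x₀).le ha'.le) ((div_le_one ha').2 hle)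
    have hρ0 : 0 ≤ ρ := sq_nonneg _
    have hH' : ω * (a₀ ^ 2 * ((((2 : ℕ) : ℝ) * u x ^ (2 - 1) * deriv u x * a ^ 2
        - u x ^ 2 * (((2 : ℕ) : ℝ) * a ^ (2 - 1) * (V₁ x * V₂ x ^ 2))) / (a ^ 2) ^ 2))
        = 2 * ω * ρ * u x * q := by
      rw [hρ, hq]
      field_simp
      ring
    -- A convex combination, with weights `ρ` and `1 - ρ`, of `(q + ω u)²` and `q² + ω² u²`.
    have hnn : 0 ≤ q ^ 2 + ω ^ 2 * u x ^ 2 + 2 * ω * ρ * u x * q := by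
      nlinarith [mul_nonneg hρ0 (sq_nonneg (q + ω * u x)),
        mul_nonneg (sub_nonneg.2 hρ1) (add_nonneg (sq_nonneg q) (sq_nonneg (ω * u x)))]
    have h₁' : q ^ 2 + ω ^ 2 * u x ^ 2 - ((g x).1 * (φ x).1 + (g x).2 * (φ x).2) ≤ F' x := h₁
    simp only [Pi.pow_apply]
    rw [hH']
    linarith
  -- The flux is `(φ₁² + φ₂²)' / 2` plus terms without derivatives of `φ`. These terms vanish at
  -- `±R`, and near `R` (near `-R`) there are points where `(φ₁² + φ₂²)'` is `≤ 0` (is `≥ 0`).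
  have hN : ContinuousOn (fun x => u x ^ 2 + w x ^ 2) (Icc (-R) R) := (cu.pow 2).add (cw.pow 2)
  have hN' (x) (hx : x ∈ Ioo (-R) R) : HasDerivAt (fun x => u x ^ 2 + w x ^ 2)
      (2 * (u x * deriv u x + w x * deriv w x)) x := by
    refine (((hu x hx).pow 2).add ((hw x hx).pow 2)).congr_deriv ?_
    push_cast; ring
  have ca' : ∀ x ∈ Icc (-R) R, deriv V₁ x ≠ 0 := fun x _ => (ha x).ne'
  have cb' : ∀ x ∈ Icc (-R) R, deriv V₂ x ≠ 0 := fun x _ => (hb x).ne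
  have cP : ContinuousOn (fun x => -(u x ^ 2 * (V₁ x * V₂ x ^ 2) / deriv V₁ x)
      - w x ^ 2 * (V₂ x * V₁ x ^ 2) / deriv V₂ x) (Icc (-R) R) :=
    (((cu.pow 2).mul (cv₁.mul (cv₂.pow 2)).continuousOn).div ca.continuousOn ca').neg.sub
      (((cw.pow 2).mul (cv₂.mul (cv₁.pow 2)).continuousOn).div cb.continuousOn cb')
  have cH : ContinuousOn H (Icc (-R) R) :=
    ((((cu.pow 2).div (ca.pow 2).continuousOn fun x hx => pow_ne_zero 2 (ca' x hx))).const_mul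
      _).const_mul _
  have uR : u R = 0 := by simp [u, h.right_eq_zero]
  have wR : w R = 0 := by simp [w, h.right_eq_zero]
  have uL : u (-R) = 0 := by simp [u, h.left_eq_zero]
  have wL : w (-R) = 0 := by simp [w, h.left_eq_zero]
  have hFeq (x) : F x = (u x * deriv u x + w x * deriv w x)
      + (-(u x ^ 2 * (V₁ x * V₂ x ^ 2) / deriv V₁ x)
        - w x ^ 2 * (V₂ x * V₁ x ^ 2) / deriv V₂ x) := by
    simp only [F, energyFlux, u, w]; ring
  have hHx₀ : H x₀ = ω * (φ x₀).1 ^ 2 := by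
    have := (ha x₀).ne'
    simp only [hH, hu_def]
    field_simp
  refine le_of_forall_pos_le_add fun ε hε => ?_
  obtain ⟨t, ht, ht₁, ht₂⟩ := exists_deriv_nonpos_lt_of_eq_zero (ε := ε / 2) hx₀.2
    (hN.mono (Icc_subset_Icc_left hx₀.1.le))
    (fun x hx => hN' x ⟨hx₀.1.trans hx.1, hx.2⟩) (fun x => by positivity) (by simp [uR, wR])
    ((cP.add cH).mono (Icc_subset_Icc_left hx₀.1.le)) (by simp [hH, uR, wR, hε])
  obtain ⟨s, hs, hs₁, hs₂⟩ := exists_deriv_nonneg_lt_of_eq_zero (ε := ε / 2) hx₀.1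
    (hN.mono (Icc_subset_Icc_right hx₀.2.le))
    (fun x hx => hN' x ⟨hx.1, hx.2.trans hx₀.2⟩) (fun x => by positivity) (by simp [uL, wL])
    (cP.neg.mono (Icc_subset_Icc_right hx₀.2.le)) (by simp [uL, wL, hε])
  simp only [Pi.add_apply, Pi.neg_apply] at ht₂ hs₂
  have := mono₁ s hs
  have := mono₂ t ht
  have := hFeq s
  have := hFeq t
  have := hm s t
  linarith

/-- The a priori bound in real form. The bound on `φ₂` is the one on `φ₁` for the reflected
solution. The constant comes from `∫ sech (θ x) dx = π / θ`, once for each component. -/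
lemma norm_le (hV : IsHeteroclinic V₁ V₂) (h : IsDirichletSolution V₁ V₂ ω R g φ)
    (hω : 0 < ω) {θ G : ℝ} (hθ : 0 < θ)
    (hG : ∀ x ∈ Ioo (-R) R, Real.cosh (θ * x) * ‖g x‖ ≤ G) {x : ℝ} (hx : x ∈ Ioo (-R) R) :
    ‖φ x‖ ≤ 2 * Real.pi / θ * ω⁻¹ * G := by
  have hG0 : 0 ≤ G := (mul_nonneg (Real.cosh_pos _).le (norm_nonneg _)).trans (hG x hx)
  obtain ⟨y, hy, hmax⟩ := isCompact_Icc.exists_isMaxOn ⟨x, Ioo_subset_Icc_self hx⟩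
    h.continuousOn.norm
  refine (hmax (Ioo_subset_Icc_self hx)).trans ?_
  change ‖φ y‖ ≤ _
  rcases (norm_nonneg (φ y)).eq_or_lt with h0 | hpos
  · rw [← h0]; positivity
  have hyI : y ∈ Ioo (-R) R := by
    refine ⟨hy.1.lt_of_ne ?_, hy.2.lt_of_ne ?_⟩ <;> rintro rfl
    · simp [h.left_eq_zero] at hpos
    · simp [h.right_eq_zero] at hpos
  set S := ‖φ y‖ with hS
  -- `arctan ∘ sinh` is a primitive of `sech`, with oscillation `π`.
  set T : ℝ → ℝ := fun x => G * S * (2 / θ * Real.arctan (Real.sinh (θ * x)))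
  have hT (x : ℝ) : HasDerivAt T (2 * S * (G / Real.cosh (θ * x))) x := by
    have h1 : HasDerivAt (fun x => Real.sinh (θ * x)) (Real.cosh (θ * x) * (θ * 1)) x :=
      ((hasDerivAt_id x).const_mul θ).sinh
    refine ((h1.arctan.const_mul (2 / θ)).const_mul (G * S)).congr_deriv ?_
    rw [add_comm 1, ← Real.cosh_sq]
    have := (Real.cosh_pos (θ * x)).ne'
    field_simp
  have hm (s t : ℝ) : T t - T s ≤ G * S * (2 * Real.pi / θ) := by
    have h1 := Real.arctan_lt_pi_div_two (Real.sinh (θ * t))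
    have h2 := Real.neg_pi_div_two_lt_arctan (Real.sinh (θ * s))
    calc T t - T s = G * S * (2 / θ *
          (Real.arctan (Real.sinh (θ * t)) - Real.arctan (Real.sinh (θ * s)))) := by
          simp only [T]; ring
      _ ≤ G * S * (2 / θ * Real.pi) := by gcongr; linarith
      _ = _ := by ring
  have hφ (x) (hx : x ∈ Ioo (-R) R) : ‖φ x‖ ≤ S := hmax (Ioo_subset_Icc_self hx)
  have hg (x) (hx : x ∈ Ioo (-R) R) :
      (g x).1 * (φ x).1 + (g x).2 * (φ x).2 ≤ 2 * S * (G / Real.cosh (θ * x)) := by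
    have hgx : ‖g x‖ ≤ G / Real.cosh (θ * x) := by
      rw [le_div_iff₀' (Real.cosh_pos _)]; exact hG x hx
    have hG' := (norm_nonneg _).trans hgx
    have k₁ : (g x).1 * (φ x).1 ≤ G / Real.cosh (θ * x) * S :=
      (le_abs_self _).trans <| (abs_mul _ _).trans_le <| mul_le_mul
        ((norm_fst_le (g x)).trans hgx) ((norm_fst_le (φ x)).trans (hφ x hx)) (abs_nonneg _) hG'
    have k₂ : (g x).2 * (φ x).2 ≤ G / Real.cosh (θ * x) * S :=
      (le_abs_self _).trans <| (abs_mul _ _).trans_le <| mul_le_mul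
        ((norm_snd_le (g x)).trans hgx) ((norm_snd_le (φ x)).trans (hφ x hx)) (abs_nonneg _) hG'
    linarith
  have hneg {x : ℝ} (hx : x ∈ Ioo (-R) R) : -x ∈ Ioo (-R) R :=
    ⟨by linarith [hx.2], by linarith [hx.1]⟩
  have b₁ := h.omega_mul_sq_fst_le hV hω hT hm hg hyI
  have b₂ := (h.reflect hV).omega_mul_sq_fst_le hV hω hT hm
    (fun x hx => by
      have := hg (-x) (hneg hx)
      rw [mul_neg, Real.cosh_neg] at this
      simpa [add_comm] using this) (hneg hyI)
  simp only [neg_neg, Prod.fst_swap] at b₂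
  have hsq : ω * S ^ 2 ≤ G * S * (2 * Real.pi / θ) := by
    rw [hS, Prod.norm_def]
    rcases max_choice ‖(φ y).1‖ ‖(φ y).2‖ with e | e
    · rw [e, Real.norm_eq_abs, sq_abs, ← Real.norm_eq_abs, ← e]; exact b₁
    · rw [e, Real.norm_eq_abs, sq_abs, ← Real.norm_eq_abs, ← e]; exact b₂
  -- The supremum `S` also enters the bound on the work `∫ |g · φ|`, so one factor cancels.
  have h3 : ω * S ≤ 2 * Real.pi / θ * G := by
    refine le_of_mul_le_mul_right ?_ hpos
    linarith
  calc S = ω⁻¹ * (ω * S) := by field_simp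
    _ ≤ ω⁻¹ * (2 * Real.pi / θ * G) := by gcongr
    _ = _ := by ring

end IsDirichletSolution

theorem theorem1p1 (V₁ V₂ : ℝ → ℝ) (hV : IsHeteroclinic V₁ V₂) (θ : ℝ) (hθ : 0 < θ) :
    ∃ C R₀ ω₀ P₀ : ℝ, 0 < C ∧ 0 < R₀ ∧ 0 < ω₀ ∧ 0 < P₀ ∧
      ∀ (R ω : ℝ) (g φ : ℝ → ℝ × ℝ), R₀ < R → 0 < ω → ω < ω₀ → P₀ < ω * R →
        IsDirichletSolution V₁ V₂ ω R g φ →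
          normC0 R φ ≤ ENNReal.ofReal (C * ω⁻¹) * weightedNormC0 θ R g := by
  refine ⟨2 * Real.pi / θ, 1, 1, 1, by positivity, one_pos, one_pos, one_pos, ?_⟩
  intro R ω g φ _ hω _ _ h
  have hC : 0 < 2 * Real.pi / θ * ω⁻¹ := by positivity
  -- If the weighted norm is infinite, the right-hand side is infinite since `C * ω⁻¹ ≠ 0`.
  by_cases htop : weightedNormC0 θ R g = ⊤
  · rw [htop, ENNReal.mul_top (by simpa using hC)]
    exact le_top
  have hG (x) (hx : x ∈ Ioo (-R) R) :
      Real.cosh (θ * x) * ‖g x‖ ≤ (weightedNormC0 θ R g).toReal := by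
    have hle : ‖Real.cosh (θ * x) • g x‖ₑ ≤ weightedNormC0 θ R g :=
      le_iSup₂ (f := fun x (_ : x ∈ Ioo (-R) R) => ‖Real.cosh (θ * x) • g x‖ₑ) x hx
    have := ENNReal.toReal_mono htop hle
    rwa [toReal_enorm, norm_smul, Real.norm_eq_abs, abs_of_pos (Real.cosh_pos _)] at this
  refine iSup₂_le fun x hx => ?_
  rw [← ENNReal.ofReal_toReal htop, ← ENNReal.ofReal_mul hC.le, ← ofReal_norm]
  exact ENNReal.ofReal_le_ofReal (h.norm_le hV hω hθ hG hx)
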